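/- Let $d\ge 2$ be an even integer, and let $f:\mathbb R^n\to[0,\infty)$ be an integrable log-concave function with $\int_{\mathbb R^n} f\,dx>0$ and $\|f\|_\infty=\sup f=f(0)=1$. For a real homogeneous polynomial $g$ of degree $d$ on $\mathbb R^n$ put $G_1(g)=\{x\in\mathbb R^n: g(x)\le 1\}$, write $|G_1(g)|\in[0,\infty]$ for its Lebesgue measure, and let $\mathbb F_d(\mathbb R^n)$ be the set of those $g$ with $|G_1(g)|<\infty$. Call a pair $(t,g)$ admissible if $t\ge 1$, $g$ is a homogeneous polynomial of degree $d$ (the zero polynomial included) which is non-negative on $\mathbb R^n$ (so that the real root $g^{1/d}$ is defined), and $$f(x)\le t\,e^{-g(x)^{1/d}}\qquad\text{for all }x\in\mathbb R^n.$$ Then $$\int_{\mathbb R^n} t\,e^{-g(x)^{1/d}}\,dx=t\,n!\,|G_1(g)|\in[0,\infty]$$ for every admissible pair $(t,g)$, and there exists an admissible pair $(t_1,g_1)\in[1,\infty)\times\mathbb F_d(\mathbb R^n)$ which minimizes this common quantity among all admissible pairs. -/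

import Mathlib

open MeasureTheory

noncomputable section

/-- A log-concave function on `ℝⁿ`: nonnegative, with
`f(x)^a f(y)^b ≤ f(a x + b y)` for all weights `a, b > 0`, `a + b = 1`
(equivalently `f = exp (-u)` with `u` convex and values in `(-∞, ∞]`). -/
structure IsLogConcave {n : ℕ} (f : (Fin n → ℝ) → ℝ) : Prop where
  nonneg : ∀ x, 0 ≤ f x
  rpow_mul_rpow_le : ∀ x y : Fin n → ℝ, ∀ a b : ℝ, 0 < a → 0 < b → a + b = 1 →
    f x ^ a * f y ^ b ≤ f (a • x + b • y)

/-- The sublevel set `G₁(g) = {x ∈ ℝⁿ : g(x) ≤ 1}`. -/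
def sublevelOne {n : ℕ} (g : MvPolynomial (Fin n) ℝ) : Set (Fin n → ℝ) :=
  {x | MvPolynomial.eval x g ≤ 1}

/-- `F_d(ℝⁿ)`: the real homogeneous polynomials `g` of degree `d` in `n` variables for which
`G₁(g)` has finite Lebesgue measure. -/
def finiteVolumeForms (n d : ℕ) : Set (MvPolynomial (Fin n) ℝ) :=
  {g | g ∈ MvPolynomial.homogeneousSubmodule (Fin n) ℝ d ∧ volume (sublevelOne g) < ⊤}

/-- The function `x ↦ t exp (-g(x)^{1/d})`. -/
def expRoot {n : ℕ} (d : ℕ) (t : ℝ) (g : MvPolynomial (Fin n) ℝ) (x : Fin n → ℝ) : ℝ :=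
  t * Real.exp (-(MvPolynomial.eval x g) ^ (1 / (d : ℝ)))

/-- The pair `(t, g)` is admissible for `f`: `t ≥ 1`, `g` is homogeneous of degree `d`, and
`f ≤ t exp (-g^{1/d})` on `ℝⁿ`. As `d` is even, the real root `g(x)^{1/d}` exists exactly when
`g(x) ≥ 0`, which is therefore part of the condition. -/
structure IsAdmissible {n : ℕ} (f : (Fin n → ℝ) → ℝ) (d : ℕ) (t : ℝ)
    (g : MvPolynomial (Fin n) ℝ) : Prop where
  one_le : 1 ≤ t
  homogeneous : g ∈ MvPolynomial.homogeneousSubmodule (Fin n) ℝ d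
  nonneg : ∀ x, 0 ≤ MvPolynomial.eval x g
  le_expRoot : ∀ x, f x ≤ expRoot d t g x

/-- The objective `∫ t exp (-g(x)^{1/d}) dx`, with values in `[0, ∞]`. -/
def objective {n : ℕ} (d : ℕ) (t : ℝ) (g : MvPolynomial (Fin n) ℝ) : ENNReal :=
  ∫⁻ x, ENNReal.ofReal (expRoot d t g x)

/-- `(t, g)` solves the minimization problem: it is admissible and minimizes the objective
among all admissible pairs. -/
def IsSolution {n : ℕ} (f : (Fin n → ℝ) → ℝ) (d : ℕ) (t : ℝ)
    (g : MvPolynomial (Fin n) ℝ) : Prop :=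
  IsAdmissible f d t g ∧
    ∀ (s : ℝ) (h : MvPolynomial (Fin n) ℝ), IsAdmissible f d s h →
      objective d t g ≤ objective d s h

end

open scoped Pointwise

/-! For the integral formula, `g^{1/d}` is homogeneous of degree one, so its sublevel set at `s` has
volume `s^n |G₁(g)|`. Fubini and `∫ s^n e^{-s} ds = n!` conclude.

Existence is the direct method. Log-concavity and integrability make `f` decay exponentially, which
yields an admissible pair with finite objective. Some superlevel set `{a < f}` contains a ball,
where admissibility forces `g ≤ log(t/a)^d`. Hence the objective is at least a constant times `t /
log(t/a)^n`, which bounds `t` (`exists_forall_scale_le`); then `g` is bounded on the ball, hence so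
are its coordinates (`exists_coordinate_bound`). A minimizing sequence thus has a convergent
subsequence. Admissibility passes to the limit, and Fatou's lemma gives minimality. -/

/-! ### The integral formula. -/

theorem eval_smul_of_mem_homogeneousSubmodule {n d : ℕ} {g : MvPolynomial (Fin n) ℝ}
    (hg : g ∈ MvPolynomial.homogeneousSubmodule (Fin n) ℝ d) (s : ℝ) (x : Fin n → ℝ) :
    MvPolynomial.eval (s • x) g = s ^ d * MvPolynomial.eval x g := by
  have hg' := (MvPolynomial.mem_homogeneousSubmodule d g).1 hg
  rw [MvPolynomial.eval_eq, MvPolynomial.eval_eq, Finset.mul_sum]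
  refine Finset.sum_congr rfl fun m hm => ?_
  have h1 : d = ∑ i ∈ m.support, m i := hg'.degree_eq_sum_deg_support hm
  simp only [Pi.smul_apply, smul_eq_mul, mul_pow, Finset.prod_mul_distrib]
  rw [Finset.prod_pow_eq_pow_sum, ← h1]
  ring

theorem lintegral_exp_neg_mul_pow (n : ℕ) :
    ∫⁻ s in Set.Ioi (0 : ℝ), ENNReal.ofReal (Real.exp (-s) * s ^ n) = n.factorial := by
  have hpos : (0 : ℝ) < n + 1 := by positivity
  have hint := Real.GammaIntegral_convergent hpos
  have heq := Real.Gamma_eq_integral hpos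
  simp only [add_sub_cancel_right, Real.rpow_natCast] at hint heq
  rw [← ofReal_integral_eq_lintegral_ofReal hint, ← heq, Real.Gamma_nat_eq_factorial,
    ENNReal.ofReal_natCast]
  refine (ae_restrict_mem measurableSet_Ioi).mono fun s hs => ?_
  have : (0 : ℝ) < s := hs
  simp only [Pi.zero_apply]
  positivity

theorem lintegral_Ici_exp_neg (c : ℝ) :
    ∫⁻ s in Set.Ici c, ENNReal.ofReal (Real.exp (-s)) = ENNReal.ofReal (Real.exp (-c)) := by
  rw [← setLIntegral_congr (Ioi_ae_eq_Ici (a := c) (μ := volume)), ← integral_exp_neg_Ioi c,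
    ofReal_integral_eq_lintegral_ofReal]
  · exact integrableOn_exp_neg_Ioi c
  · exact Filter.Eventually.of_forall fun s => (Real.exp_pos _).le

/-- A nonnegative measurable function, positively homogeneous of degree one, satisfies
`∫ exp (-N) = n! |{N ≤ 1}|`. -/
theorem lintegral_exp_neg_of_homogeneous {n : ℕ} {N : (Fin n → ℝ) → ℝ} (hm : Measurable N)
    (h0 : ∀ x, 0 ≤ N x) (hN : ∀ s : ℝ, 0 < s → ∀ x, N (s • x) = s * N x) :
    ∫⁻ x, ENNReal.ofReal (Real.exp (-N x)) = (n.factorial : ENNReal) * volume {x | N x ≤ 1} := by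
  have hscale : ∀ s : ℝ, 0 < s →
      volume {x | N x ≤ s} = ENNReal.ofReal (s ^ n) * volume {x | N x ≤ 1} := by
    intro s hs
    have : {x | N x ≤ s} = s • {x | N x ≤ 1} := by
      ext x
      rw [Set.mem_smul_set_iff_inv_smul_mem₀ hs.ne']
      simp only [Set.mem_ofPred_eq]
      rw [hN _ (inv_pos.2 hs), inv_mul_le_iff₀ hs, mul_one]
    rw [this, Measure.addHaar_smul, Module.finrank_fin_fun, abs_of_pos (by positivity)]
  have hset : MeasurableSet {p : (Fin n → ℝ) × ℝ | N p.1 ≤ p.2} :=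
    measurableSet_le (hm.comp measurable_fst) measurable_snd
  -- Write `e^{-N(x)}` as the integral of `e^{-s}` over `s ≥ N(x)`, then integrate in `x` first.
  set F : (Fin n → ℝ) → ℝ → ENNReal := fun x s =>
    {p : (Fin n → ℝ) × ℝ | N p.1 ≤ p.2}.indicator
      (fun p => ENNReal.ofReal (Real.exp (-p.2))) (x, s) with hF
  have hFm : Measurable (Function.uncurry F) := by
    refine Measurable.indicator ?_ hset
    fun_prop
  have h1 : ∀ x, ∫⁻ s in Set.Ioi (0 : ℝ), F x s = ENNReal.ofReal (Real.exp (-N x)) := by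
    intro x
    have : ∀ s, F x s = (Set.Ici (N x)).indicator (fun s => ENNReal.ofReal (Real.exp (-s))) s :=
      fun s => by simp [hF, Set.indicator]
    simp_rw [this]
    rw [setLIntegral_congr (Ioi_ae_eq_Ici (a := (0 : ℝ)) (μ := volume)),
      setLIntegral_indicator measurableSet_Ici, Set.Ici_inter_Ici, sup_eq_left.2 (h0 x)]
    exact lintegral_Ici_exp_neg _
  have h2 : ∀ s ∈ Set.Ioi (0 : ℝ), ∫⁻ x, F x s =
      ENNReal.ofReal (Real.exp (-s) * s ^ n) * volume {x | N x ≤ 1} := by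
    intro s hs
    have : ∀ x, F x s = {x | N x ≤ s}.indicator (fun _ => ENNReal.ofReal (Real.exp (-s))) x :=
      fun x => by simp [hF, Set.indicator]
    simp_rw [this]
    rw [lintegral_indicator_const (measurableSet_le hm measurable_const), hscale s hs,
      ENNReal.ofReal_mul (Real.exp_pos _).le, mul_assoc]
  simp_rw [← h1]
  rw [lintegral_lintegral_swap hFm.aemeasurable, setLIntegral_congr_fun measurableSet_Ioi h2,
    lintegral_mul_const _ (by fun_prop), lintegral_exp_neg_mul_pow]

theorem measurable_expRoot {n : ℕ} (d : ℕ) (t : ℝ) (g : MvPolynomial (Fin n) ℝ) :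
    Measurable (expRoot d t g) := by
  have := (MvPolynomial.continuous_eval g).measurable
  unfold expRoot
  fun_prop

theorem rpow_one_div_le_one_iff {d : ℕ} (hd : 0 < d) {y : ℝ} (hy : 0 ≤ y) :
    y ^ (1 / (d : ℝ)) ≤ 1 ↔ y ≤ 1 := by
  have hd' : (0 : ℝ) < d := by exact_mod_cast hd
  rw [one_div, Real.rpow_inv_le_iff_of_pos hy zero_le_one hd', Real.one_rpow]

theorem objective_eq {n d : ℕ} (hd : 0 < d) {t : ℝ} (ht : 0 ≤ t) {g : MvPolynomial (Fin n) ℝ}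
    (hg : g ∈ MvPolynomial.homogeneousSubmodule (Fin n) ℝ d)
    (h0 : ∀ x, 0 ≤ MvPolynomial.eval x g) :
    objective d t g = ENNReal.ofReal t * (n.factorial : ENNReal) * volume (sublevelOne g) := by
  have hm : Measurable fun x => (MvPolynomial.eval x g) ^ (1 / (d : ℝ)) := by
    have := (MvPolynomial.continuous_eval g).measurable
    fun_prop
  have key := lintegral_exp_neg_of_homogeneous hm (fun x => Real.rpow_nonneg (h0 x) _)
    (fun s hs x => by
      rw [eval_smul_of_mem_homogeneousSubmodule hg, Real.mul_rpow (by positivity) (h0 x),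
        one_div, Real.pow_rpow_inv_natCast hs.le hd.ne'])
  simp_rw [fun x => rpow_one_div_le_one_iff hd (h0 x)] at key
  unfold objective expRoot sublevelOne
  simp_rw [ENNReal.ofReal_mul ht]
  rw [lintegral_const_mul _ (by fun_prop), key, mul_assoc]

/-! ### Superlevel sets and decay of `f`. -/

/-- A convex set of finite measure that contains a ball is bounded. -/
theorem Convex.isBounded_of_measure_lt_top {E : Type*} [NormedAddCommGroup E] [NormedSpace ℝ E]
    [MeasurableSpace E] [BorelSpace E] [FiniteDimensional ℝ E] (μ : Measure E)
    [μ.IsAddHaarMeasure] {K : Set E} (hK : Convex ℝ K) {x₀ : E} {r : ℝ} (hr : 0 < r)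
    (hball : Metric.ball x₀ r ⊆ K) (hfin : μ K < ⊤) : Bornology.IsBounded K := by
  by_contra hb
  have hv : μ (Metric.ball (0 : E) (r / 2)) ≠ 0 :=
    (Metric.measure_ball_pos μ _ (by positivity)).ne'
  obtain ⟨m, hm⟩ := ENNReal.exists_nat_mul_gt hv hfin.ne
  have hm0 : 0 < m := by
    rcases Nat.eq_zero_or_pos m with rfl | h
    · simp at hm
    · exact h
  have hm' : (0 : ℝ) < m := by exact_mod_cast hm0
  obtain ⟨y, hyK, hy⟩ : ∃ y ∈ K, 2 * m * r < ‖y - x₀‖ := by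
    by_contra! h
    exact hb ((Metric.isBounded_closedBall (x := x₀) (r := 2 * m * r)).subset fun y hy => by
      simpa [dist_eq_norm] using h y hy)
  -- The `p i` lie on the first half of the segment from `x₀` to `y`, so convexity places a ball of
  -- radius `r / 2` around each inside `K`. Their spacing exceeds `r`, so these `m` balls are
  -- disjoint and overfill `K`.
  let p : ℕ → E := fun i => x₀ + ((i : ℝ) / (2 * m)) • (y - x₀)
  have hsub : ∀ i ∈ Finset.range m, Metric.ball (p i) (r / 2) ⊆ K := by
    intro i hi z hz
    have hi' : (i : ℝ) < m := by exact_mod_cast Finset.mem_range.1 hi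
    have hl0 : 0 ≤ (i : ℝ) / (2 * m) := by positivity
    have hl1 : (i : ℝ) / (2 * m) ≤ 1 / 2 := by
      rw [div_le_div_iff₀ (by positivity) two_pos]; linarith
    set l := (i : ℝ) / (2 * m) with hl
    have hpos : 0 < 1 - l := by linarith
    have hw : x₀ + (1 - l)⁻¹ • (z - p i) ∈ K := by
      refine hball ?_
      rw [Metric.mem_ball, dist_eq_norm] at hz ⊢
      rw [add_sub_cancel_left, norm_smul, norm_inv, Real.norm_of_nonneg hpos.le,
        inv_mul_lt_iff₀ hpos]
      nlinarith
    have := hK hw hyK hpos.le hl0 (by ring)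
    convert this using 1
    rw [smul_add, smul_smul, mul_inv_cancel₀ hpos.ne']
    simp only [p, ← hl]
    module
  have hdisj : Set.PairwiseDisjoint (↑(Finset.range m)) fun i => Metric.ball (p i) (r / 2) := by
    intro i _ j _ hij
    refine Metric.ball_disjoint_ball ?_
    have h1 : p i - p j = (((i : ℝ) - j) / (2 * m)) • (y - x₀) := by
      simp only [p]; module
    have h2 : (1 : ℝ) ≤ |(i : ℝ) - j| := by
      have : (1 : ℤ) ≤ |(i : ℤ) - j| := Int.one_le_abs (by omega)
      exact_mod_cast this
    rw [dist_eq_norm, h1, norm_smul, Real.norm_eq_abs, abs_div, abs_of_pos (by positivity :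
      (0 : ℝ) < 2 * m), div_mul_eq_mul_div, le_div_iff₀ (by positivity)]
    nlinarith [norm_nonneg (y - x₀)]
  have hle : (m : ENNReal) * μ (Metric.ball (0 : E) (r / 2)) ≤ μ K := by
    calc (m : ENNReal) * μ (Metric.ball (0 : E) (r / 2))
        = ∑ i ∈ Finset.range m, μ (Metric.ball (p i) (r / 2)) := by
          simp [Measure.addHaar_ball_center]
      _ = μ (⋃ i ∈ Finset.range m, Metric.ball (p i) (r / 2)) :=
          (measure_biUnion_finset hdisj fun _ _ => measurableSet_ball).symm
      _ ≤ μ K := measure_mono (Set.iUnion₂_subset hsub)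
  exact absurd hm (not_lt.2 hle)

/-- The frontier of a convex set is null, so a convex set with empty interior is null. -/
theorem Convex.exists_ball_subset_of_measure_ne_zero {E : Type*} [NormedAddCommGroup E]
    [NormedSpace ℝ E] [MeasurableSpace E] [BorelSpace E] [FiniteDimensional ℝ E] (μ : Measure E)
    [μ.IsAddHaarMeasure] {K : Set E} (hK : Convex ℝ K) (h : μ K ≠ 0) :
    ∃ x₀ r, 0 < r ∧ Metric.ball x₀ r ⊆ K := by
  have hne : (interior K).Nonempty := by
    by_contra hempty
    rw [Set.not_nonempty_iff_eq_empty] at hempty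
    refine h (measure_mono_null ?_ (hK.addHaar_frontier μ))
    rw [frontier, hempty, Set.sdiff_empty]
    exact subset_closure
  obtain ⟨x₀, hx₀⟩ := hne
  obtain ⟨r, hr, hsub⟩ := Metric.isOpen_iff.1 isOpen_interior x₀ hx₀
  exact ⟨x₀, r, hr, hsub.trans interior_subset⟩

theorem IsLogConcave.convex_superlevel {n : ℕ} {f : (Fin n → ℝ) → ℝ} (hf : IsLogConcave f)
    {a : ℝ} (ha : 0 < a) : Convex ℝ {x | a < f x} := by
  rw [convex_iff_forall_pos]
  intro x hx y hy α β hα hβ hαβ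
  refine lt_of_lt_of_le ?_ (hf.rpow_mul_rpow_le x y α β hα hβ hαβ)
  calc a = a ^ α * a ^ β := by rw [← Real.rpow_add ha, hαβ, Real.rpow_one]
    _ < f x ^ α * f y ^ β := by
      have h1 := Real.rpow_lt_rpow ha.le hx hα
      have h2 := Real.rpow_lt_rpow ha.le hy hβ
      exact mul_lt_mul'' h1 h2 (by positivity) (by positivity)

theorem exists_superlevel_ball {n : ℕ} {f : (Fin n → ℝ) → ℝ} (hf : IsLogConcave f)
    (hint : Integrable f) (hpos : 0 < ∫ x, f x) :
    ∃ a : ℝ, 0 < a ∧ a < 1 ∧ ∃ x₀ r, 0 < r ∧ Metric.ball x₀ r ⊆ {x | a < f x} := by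
  have hsupp := (integral_pos_iff_support_of_nonneg hf.nonneg hint).1 hpos
  -- The shift by 2 keeps every level below 1.
  have hunion : Function.support f ⊆ ⋃ k : ℕ, {x | 1 / ((k : ℝ) + 2) < f x} := by
    intro x hx
    have hfx : 0 < f x := lt_of_le_of_ne (hf.nonneg x) (Ne.symm hx)
    obtain ⟨k, hk⟩ := exists_nat_one_div_lt hfx
    refine Set.mem_iUnion.2 ⟨k, lt_of_le_of_lt ?_ hk⟩
    exact one_div_le_one_div_of_le (by positivity) (by linarith)
  obtain ⟨k, hk⟩ := exists_measure_pos_of_not_measure_iUnion_null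
    (fun h => (hsupp.trans_le (measure_mono hunion)).ne' h)
  have h0 : 0 < 1 / ((k : ℝ) + 2) := by positivity
  exact ⟨1 / ((k : ℝ) + 2), h0, by rw [div_lt_one (by positivity)]; linarith [k.cast_nonneg (α := ℝ)],
    (hf.convex_superlevel h0).exists_ball_subset_of_measure_ne_zero volume hk.ne'⟩

/-- An integrable log-concave function with maximum `f 0 = 1` decays exponentially. -/
theorem exists_exponential_decay {n : ℕ} {f : (Fin n → ℝ) → ℝ} (hf : IsLogConcave f)
    (hint : Integrable f) (hpos : 0 < ∫ x, f x) (hle : ∀ x, f x ≤ 1) (h0 : f 0 = 1) :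
    ∃ t κ : ℝ, 1 ≤ t ∧ 0 < κ ∧ ∀ x, f x ≤ t * Real.exp (-(κ * ‖x‖)) := by
  obtain ⟨a, ha0, ha1, x₀, r, hr, hball⟩ := exists_superlevel_ball hf hint hpos
  have hbdd := (hf.convex_superlevel ha0).isBounded_of_measure_lt_top volume hr hball
    (hint.measure_gt_lt_top ha0)
  obtain ⟨R, hR0, hR⟩ := hbdd.exists_pos_norm_lt
  have hlog : Real.log a < 0 := Real.log_neg ha0 ha1
  -- With these constants the bound equals 1 on the sphere of radius `R`, so it is trivial inside.
  refine ⟨a⁻¹, -Real.log a / R, (one_le_inv₀ ha0).2 ha1.le, by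
    have := neg_pos.2 hlog
    positivity, fun x => ?_⟩
  have hrew : a⁻¹ * Real.exp (-(-Real.log a / R * ‖x‖)) = Real.exp (Real.log a * (‖x‖ / R - 1)) := by
    rw [← Real.exp_log ha0, ← Real.exp_neg, ← Real.exp_add, Real.log_exp]
    congr 1
    field_simp
    ring
  rw [hrew]
  rcases le_or_gt ‖x‖ R with hx | hx
  · refine (hle x).trans (Real.one_le_exp ?_)
    have : ‖x‖ / R ≤ 1 := (div_le_one hR0).2 hx
    nlinarith
  · have hx0 : 0 < ‖x‖ := hR0.trans hx
    -- The point `s • x` has norm `R`, hence lies outside `{a < f}`; log-concavity between `x` and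
    -- `0` gives `f x ^ s ≤ a`.
    set s := R / ‖x‖ with hs
    have hs0 : 0 < s := by positivity
    have hs1 : s < 1 := (div_lt_one hx0).2 hx
    have h1 := hf.rpow_mul_rpow_le x 0 s (1 - s) hs0 (by linarith) (by ring)
    rw [h0, Real.one_rpow, mul_one, smul_zero, add_zero] at h1
    have h2 : f (s • x) ≤ a := by
      by_contra! h
      have := hR (s • x) h
      rw [norm_smul, Real.norm_of_nonneg hs0.le, hs, div_mul_cancel₀ _ hx0.ne'] at this
      exact lt_irrefl _ this
    have h3 : f x ≤ a ^ s⁻¹ :=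
      (Real.le_rpow_inv_iff_of_pos (hf.nonneg x) ha0.le hs0).2 (h1.trans h2)
    refine h3.trans ?_
    rw [Real.rpow_def_of_pos ha0, hs, inv_div]
    exact Real.exp_le_exp.2 (by nlinarith)

/-! ### A competitor with finite objective. -/

theorem exists_admissible_objective_lt_top {n d : ℕ} (hd : Even d) (hd_pos : 0 < d)
    {f : (Fin n → ℝ) → ℝ} {t κ : ℝ} (ht : 1 ≤ t) (hκ : 0 < κ)
    (hf : ∀ x, f x ≤ t * Real.exp (-(κ * ‖x‖))) :
    ∃ g, IsAdmissible f d t g ∧ objective d t g < ⊤ := by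
  -- In the sup norm, `∑ |x i|^d ≤ n ‖x‖^d`; using `n + 1` avoids a zero denominator when `n = 0`.
  set c : ℝ := κ ^ d / (n + 1) with hc
  have hc0 : 0 < c := by positivity
  let g : MvPolynomial (Fin n) ℝ := MvPolynomial.C c * ∑ i, MvPolynomial.X i ^ d
  have hev : ∀ x, MvPolynomial.eval x g = c * ∑ i, |x i| ^ d := fun x => by
    simp [g, hd.pow_abs]
  have hg : g ∈ MvPolynomial.homogeneousSubmodule (Fin n) ℝ d := by
    rw [MvPolynomial.mem_homogeneousSubmodule]
    exact (MvPolynomial.IsHomogeneous.sum _ _ _ fun i _ =>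
      MvPolynomial.isHomogeneous_X_pow i d).C_mul c
  have h0 : ∀ x, 0 ≤ MvPolynomial.eval x g := fun x => by rw [hev]; positivity
  have hup : ∀ x, MvPolynomial.eval x g ≤ (κ * ‖x‖) ^ d := by
    intro x
    have h1 : ∑ i, |x i| ^ d ≤ n * ‖x‖ ^ d := by
      refine (Finset.sum_le_card_nsmul Finset.univ _ (‖x‖ ^ d) fun i _ =>
        pow_le_pow_left₀ (abs_nonneg _) (norm_le_pi_norm x i) d).trans (by simp)
    rw [hev, mul_pow, hc, div_mul_eq_mul_div, div_le_iff₀ (by positivity), mul_assoc]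
    refine mul_le_mul_of_nonneg_left (h1.trans ?_) (by positivity)
    nlinarith [pow_nonneg (norm_nonneg x) d]
  have hfin : volume (sublevelOne g) < ⊤ := by
    refine lt_of_le_of_lt (measure_mono ?_)
      (measure_closedBall_lt_top (x := (0 : Fin n → ℝ)) (r := max 1 c⁻¹))
    intro x hx
    rw [mem_closedBall_zero_iff, pi_norm_le_iff_of_nonneg (by positivity)]
    intro i
    rw [Real.norm_eq_abs]
    by_contra! h
    obtain ⟨h1, h2⟩ := max_lt_iff.1 h
    have h3 : |x i| ≤ |x i| ^ d := le_self_pow₀ h1.le hd_pos.ne'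
    have h4 : |x i| ^ d ≤ ∑ j, |x j| ^ d :=
      Finset.single_le_sum (f := fun j => |x j| ^ d) (fun j _ => by positivity) (Finset.mem_univ i)
    have h5 : c * ∑ j, |x j| ^ d ≤ 1 := by
      rw [← hev]; exact hx
    have h6 : 1 < c * |x i| := (inv_lt_iff_one_lt_mul₀' hc0).1 h2
    nlinarith
  have hadm : IsAdmissible f d t g := by
    refine ⟨ht, hg, h0, fun x => (hf x).trans ?_⟩
    refine mul_le_mul_of_nonneg_left (Real.exp_le_exp.2 (neg_le_neg ?_)) (by linarith)
    rw [one_div, Real.rpow_inv_le_iff_of_pos (h0 x) (by positivity) (by exact_mod_cast hd_pos),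
      Real.rpow_natCast]
    exact hup x
  refine ⟨g, hadm, ?_⟩
  rw [objective_eq hd_pos (by linarith) hg h0]
  exact ENNReal.mul_lt_top (ENNReal.mul_lt_top ENNReal.ofReal_lt_top (by simp)) hfin

/-! ### Coercivity in `t`. -/

theorem IsAdmissible.rpow_le_log {n d : ℕ} {f : (Fin n → ℝ) → ℝ} {t a : ℝ}
    {g : MvPolynomial (Fin n) ℝ} (h : IsAdmissible f d t g) (ha : 0 < a) {x : Fin n → ℝ}
    (hx : a < f x) : (MvPolynomial.eval x g) ^ (1 / (d : ℝ)) ≤ Real.log (t / a) := by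
  have ht : 0 < t := by linarith [h.one_le]
  have h1 : a ≤ t * Real.exp (-(MvPolynomial.eval x g) ^ (1 / (d : ℝ))) :=
    hx.le.trans (h.le_expRoot x)
  rw [Real.le_log_iff_exp_le (by positivity), le_div_iff₀ ha]
  rw [Real.exp_neg, ← div_eq_mul_inv, le_div_iff₀ (Real.exp_pos _)] at h1
  linarith

theorem IsAdmissible.eval_le_log_pow {n d : ℕ} (hd : 0 < d) {f : (Fin n → ℝ) → ℝ} {t a : ℝ}
    {g : MvPolynomial (Fin n) ℝ} (h : IsAdmissible f d t g) (ha : 0 < a) {x : Fin n → ℝ}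
    (hx : a < f x) : MvPolynomial.eval x g ≤ Real.log (t / a) ^ d := by
  have h1 := h.rpow_le_log ha hx
  have h2 := pow_le_pow_left₀ (Real.rpow_nonneg (h.nonneg x) _) h1 d
  rwa [one_div, Real.rpow_inv_natCast_pow (h.nonneg x) hd.ne'] at h2

/-- Since `g ≤ L^d` on `B` with `L = log(t/a)`, homogeneity puts `L⁻¹ • B` inside `G₁(g)`. The
factor `n!` is discarded. -/
theorem IsAdmissible.le_objective {n d : ℕ} (hd : 0 < d) {f : (Fin n → ℝ) → ℝ} {t a : ℝ}
    {g : MvPolynomial (Fin n) ℝ} (h : IsAdmissible f d t g) (ha0 : 0 < a) (ha1 : a < 1)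
    {B : Set (Fin n → ℝ)} (hB : B ⊆ {x | a < f x}) :
    ENNReal.ofReal (t / Real.log (t / a) ^ n) * volume B ≤ objective d t g := by
  have ht : 0 < t := by linarith [h.one_le]
  have hL : 0 < Real.log (t / a) :=
    Real.log_pos ((one_lt_div ha0).2 (by linarith [h.one_le]))
  set L := Real.log (t / a)
  have hsub : L⁻¹ • B ⊆ sublevelOne g := by
    rintro _ ⟨x, hx, rfl⟩
    have h1 := h.eval_le_log_pow hd ha0 (hB hx)
    simp only [sublevelOne, Set.mem_ofPred_eq]
    rw [eval_smul_of_mem_homogeneousSubmodule h.homogeneous, inv_pow,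
      inv_mul_le_iff₀ (by positivity), mul_one]
    exact h1
  rw [objective_eq hd ht.le h.homogeneous h.nonneg]
  calc ENNReal.ofReal (t / L ^ n) * volume B
      = ENNReal.ofReal t * 1 * volume (L⁻¹ • B) := by
        rw [Measure.addHaar_smul, Module.finrank_fin_fun, abs_of_pos (by positivity), inv_pow,
          div_eq_mul_inv, ENNReal.ofReal_mul ht.le, mul_one, mul_assoc]
    _ ≤ _ := by
        gcongr
        exact_mod_cast Nat.one_le_iff_ne_zero.2 n.factorial_ne_zero

theorem exists_forall_scale_le {n d : ℕ} (hd : 0 < d) {f : (Fin n → ℝ) → ℝ} {a : ℝ}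
    (ha0 : 0 < a) (ha1 : a < 1) {B : Set (Fin n → ℝ)} (hB : B ⊆ {x | a < f x})
    (hB0 : volume B ≠ 0) {M : ENNReal} (hM : M ≠ ⊤) :
    ∃ T : ℝ, ∀ t g, IsAdmissible f d t g → objective d t g ≤ M → t ≤ T := by
  have hq : M / volume B ≠ ⊤ := ENNReal.div_ne_top hM hB0
  -- With `L = log(t/a)`, the quantity `t / L^n` is `a e^L / L^n`, which tends to infinity with `L`.
  obtain ⟨L₀, hL₀⟩ := Filter.eventually_atTop.1
    ((Real.tendsto_exp_div_pow_atTop n).eventually_gt_atTop ((M / volume B).toReal / a))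
  refine ⟨a * Real.exp L₀, fun t g h hobj => ?_⟩
  by_contra! hlt
  have ht : 0 < t := by linarith [h.one_le]
  have hL : L₀ ≤ Real.log (t / a) := by
    rw [Real.le_log_iff_exp_le (by positivity), le_div_iff₀ ha0]
    linarith
  have h1 := hL₀ _ hL
  rw [Real.exp_log (by positivity), div_lt_iff₀ ha0] at h1
  have h2 : (M / volume B).toReal < t / Real.log (t / a) ^ n := by
    rwa [div_right_comm, div_mul_cancel₀ _ ha0.ne'] at h1
  have h3 : M / volume B < ENNReal.ofReal (t / Real.log (t / a) ^ n) :=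
    (ENNReal.lt_ofReal_iff_toReal_lt hq).2 h2
  have h4 := (h.le_objective hd ha0 ha1 hB).trans hobj
  have h5 := (ENNReal.le_div_iff_mul_le (Or.inl hB0) (Or.inr hM)).2 h4
  exact absurd h3 (not_lt.2 h5)

/-! ### Compactness in the space of forms. -/

instance finite_homogeneousSubmodule (n d : ℕ) :
    Module.Finite ℝ (MvPolynomial.homogeneousSubmodule (Fin n) ℝ d) :=
  Module.Finite.iff_fg.2 (MvPolynomial.homogeneousSubmodule_fg (Fin n) ℝ d)

theorem eq_zero_of_eval_eq_zero_on_ball {n : ℕ} {g : MvPolynomial (Fin n) ℝ} {x₀ : Fin n → ℝ}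
    {r : ℝ} (hr : 0 < r) (h : ∀ x ∈ Metric.ball x₀ r, MvPolynomial.eval x g = 0) : g = 0 := by
  refine MvPolynomial.funext_set (fun i => Metric.ball (x₀ i) r) (fun i => ?_) fun x hx => ?_
  · rw [Real.ball_eq_Ioo]
    exact Set.Ioo_infinite (by linarith)
  · rw [← ball_pi _ hr] at hx
    rw [h x hx, map_zero]

/-- Evaluation at `x` as a linear functional on the forms of degree `d`. -/
noncomputable def evalForm {n : ℕ} (d : ℕ) (x : Fin n → ℝ) :
    MvPolynomial.homogeneousSubmodule (Fin n) ℝ d →ₗ[ℝ] ℝ :=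
  (MvPolynomial.aeval x : MvPolynomial (Fin n) ℝ →ₐ[ℝ] ℝ).toLinearMap ∘ₗ Submodule.subtype _

theorem evalForm_apply {n d : ℕ} (x : Fin n → ℝ)
    (g : MvPolynomial.homogeneousSubmodule (Fin n) ℝ d) :
    evalForm d x g = MvPolynomial.eval x (g : MvPolynomial (Fin n) ℝ) := by
  simp [evalForm, MvPolynomial.aeval_eq_eval]

/-- A linear functional on forms is bounded on the forms that are bounded by `b` on a ball. -/
theorem exists_functional_bound {n d : ℕ} {x₀ : Fin n → ℝ} {r : ℝ} (hr : 0 < r) (b : ℝ)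
    (l : MvPolynomial.homogeneousSubmodule (Fin n) ℝ d →ₗ[ℝ] ℝ) :
    ∃ C : ℝ, ∀ g, (∀ x ∈ Metric.ball x₀ r, |evalForm d x g| ≤ b) → |l g| ≤ C := by
  -- Evaluations on the ball span the dual, because a form killed by all of them is zero.
  have hspan : Submodule.span ℝ (evalForm d '' Metric.ball x₀ r) = ⊤ := by
    refine Submodule.span_eq_top_of_ne_zero fun g hg => ?_
    by_contra! h
    refine hg (Subtype.ext (eq_zero_of_eval_eq_zero_on_ball (x₀ := x₀) hr fun x hx => ?_))
    rw [← evalForm_apply]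
    exact h _ ⟨x, hx, rfl⟩
  have hl : l ∈ Submodule.span ℝ (evalForm d '' Metric.ball x₀ r) := hspan ▸ Submodule.mem_top
  induction hl using Submodule.span_induction with
  | mem l hl =>
    obtain ⟨x, hx, rfl⟩ := hl
    exact ⟨b, fun g hg => hg x hx⟩
  | zero => exact ⟨0, fun g _ => by simp⟩
  | add l m _ _ hl hm =>
    obtain ⟨C, hC⟩ := hl
    obtain ⟨D, hD⟩ := hm
    exact ⟨C + D, fun g hg => (abs_add_le _ _).trans (add_le_add (hC g hg) (hD g hg))⟩
  | smul s l _ hl =>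
    obtain ⟨C, hC⟩ := hl
    refine ⟨|s| * C, fun g hg => ?_⟩
    rw [LinearMap.smul_apply, smul_eq_mul, abs_mul]
    exact mul_le_mul_of_nonneg_left (hC g hg) (abs_nonneg s)

theorem exists_coordinate_bound {n d m : ℕ} {x₀ : Fin n → ℝ} {r : ℝ} (hr : 0 < r) (b : ℝ)
    (e : MvPolynomial.homogeneousSubmodule (Fin n) ℝ d ≃ₗ[ℝ] (Fin m → ℝ)) :
    ∃ C : ℝ, ∀ g, (∀ x ∈ Metric.ball x₀ r, |evalForm d x g| ≤ b) → ‖e g‖ ≤ C := by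
  choose C hC using fun i => exists_functional_bound (d := d) (x₀ := x₀) hr b
    (LinearMap.proj i ∘ₗ e.toLinearMap)
  refine ⟨∑ i, |C i|, fun g hg => ?_⟩
  rw [pi_norm_le_iff_of_nonneg (by positivity)]
  intro i
  exact ((hC i g hg).trans (le_abs_self _)).trans
    (Finset.single_le_sum (f := fun i => |C i|) (fun i _ => abs_nonneg _) (Finset.mem_univ i))

/-! ### Existence of a minimizer. -/

theorem tendsto_expRoot {n d : ℕ} (hd : 0 < d) {t : ℕ → ℝ} {g : ℕ → MvPolynomial (Fin n) ℝ}
    {t' : ℝ} {g' : MvPolynomial (Fin n) ℝ} {x : Fin n → ℝ}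
    (ht : Filter.Tendsto t Filter.atTop (nhds t'))
    (hg : Filter.Tendsto (fun k => MvPolynomial.eval x (g k)) Filter.atTop
      (nhds (MvPolynomial.eval x g'))) :
    Filter.Tendsto (fun k => expRoot d (t k) (g k) x) Filter.atTop (nhds (expRoot d t' g' x)) := by
  have hd' : (0 : ℝ) ≤ 1 / (d : ℝ) := by positivity
  exact ht.mul ((Real.continuous_exp.tendsto _).comp (hg.rpow_const (Or.inr hd')).neg)

/-- A minimum exists as soon as some admissible pair has a finite objective and some superlevel
set of `f` contains a ball. -/
theorem exists_isSolution {n d : ℕ} (hd : 0 < d) {f : (Fin n → ℝ) → ℝ} {a : ℝ} (ha0 : 0 < a)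
    (ha1 : a < 1) {x₀ : Fin n → ℝ} {r : ℝ} (hr : 0 < r)
    (hball : Metric.ball x₀ r ⊆ {x | a < f x}) {t₀ : ℝ} {g₀ : MvPolynomial (Fin n) ℝ}
    (h₀ : IsAdmissible f d t₀ g₀) (hfin : objective d t₀ g₀ < ⊤) :
    ∃ t g, IsSolution f d t g := by
  obtain ⟨T, hT⟩ := exists_forall_scale_le hd ha0 ha1 hball
    (Metric.measure_ball_pos volume x₀ hr).ne' hfin.ne
  let e := (Module.finBasis ℝ (MvPolynomial.homogeneousSubmodule (Fin n) ℝ d)).equivFun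
  obtain ⟨C, hC⟩ := exists_coordinate_bound (x₀ := x₀) hr (Real.log (T / a) ^ d) e
  -- Only pairs no worse than `(t₀, g₀)` are kept, so that `t ≤ T` holds along the sequence.
  let S : Set ENNReal :=
    {m | ∃ t g, IsAdmissible f d t g ∧ objective d t g ≤ objective d t₀ g₀ ∧ objective d t g = m}
  have hS : S.Nonempty := ⟨_, t₀, g₀, h₀, le_rfl, rfl⟩
  obtain ⟨u, -, hu, huS⟩ := exists_seq_tendsto_sInf hS (OrderBot.bddBelow S)
  choose t g hadm hle hobj using huS
  let c := fun k => e ⟨g k, (hadm k).homogeneous⟩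
  have hbound : ∀ k, (t k, c k) ∈ Set.Icc 1 T ×ˢ Metric.closedBall 0 C := by
    intro k
    have htT : t k ≤ T := hT _ _ (hadm k) (hle k)
    refine ⟨⟨(hadm k).one_le, htT⟩, mem_closedBall_zero_iff.2 (hC _ fun x hx => ?_)⟩
    rw [evalForm_apply, abs_of_nonneg ((hadm k).nonneg x)]
    refine ((hadm k).eval_le_log_pow hd ha0 (hball hx)).trans ?_
    have h1 := (hadm k).one_le
    refine pow_le_pow_left₀ (Real.log_nonneg ((one_le_div ha0).2 (by linarith))) ?_ d
    refine Real.log_le_log (by positivity) ?_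
    gcongr
  obtain ⟨⟨t₁, c₁⟩, -, φ, hφ, hlim⟩ := tendsto_subseq_of_bounded
    ((Metric.isBounded_Icc 1 T).prod Metric.isBounded_closedBall) hbound
  have hlimt : Filter.Tendsto (fun k => t (φ k)) Filter.atTop (nhds t₁) := hlim.fst_nhds
  have hlimc : Filter.Tendsto (fun k => c (φ k)) Filter.atTop (nhds c₁) := hlim.snd_nhds
  let g₁ : MvPolynomial (Fin n) ℝ := e.symm c₁
  have hlimg : ∀ x, Filter.Tendsto (fun k => MvPolynomial.eval x (g (φ k))) Filter.atTop
      (nhds (MvPolynomial.eval x g₁)) := by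
    intro x
    -- Evaluation is linear in the coordinates, hence continuous.
    have h1 := ((evalForm d x ∘ₗ e.symm.toLinearMap).continuous_of_finiteDimensional.tendsto
      c₁).comp hlimc
    refine (h1.congr fun k => ?_).trans_eq ?_
    · simp [c, evalForm_apply]
    · simp [g₁, evalForm_apply]
  have hlimF := fun x => tendsto_expRoot hd hlimt (hlimg x)
  have hadm₁ : IsAdmissible f d t₁ g₁ :=
    ⟨ge_of_tendsto' hlimt fun k => (hadm _).one_le, (e.symm c₁).2,
      fun x => ge_of_tendsto' (hlimg x) fun k => (hadm _).nonneg x,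
      fun x => ge_of_tendsto' (hlimF x) fun k => (hadm _).le_expRoot x⟩
  have hfatou : objective d t₁ g₁ ≤ sInf S := by
    have h1 := lintegral_liminf_le (μ := volume) (u := Filter.atTop)
      fun k => (measurable_expRoot d (t (φ k)) (g (φ k))).ennreal_ofReal
    have h2 : ∀ x, Filter.liminf (fun k => ENNReal.ofReal (expRoot d (t (φ k)) (g (φ k)) x))
        Filter.atTop = ENNReal.ofReal (expRoot d t₁ g₁ x) :=
      fun x => (ENNReal.tendsto_ofReal (hlimF x)).liminf_eq
    simp_rw [h2] at h1
    refine h1.trans (le_of_eq ?_)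
    refine Filter.Tendsto.liminf_eq ((hu.comp hφ.tendsto_atTop).congr fun k => ?_)
    exact (hobj (φ k)).symm
  refine ⟨t₁, g₁, hadm₁, fun s h hs => ?_⟩
  rcases le_total (objective d s h) (objective d t₀ g₀) with hcmp | hcmp
  · exact hfatou.trans (sInf_le ⟨s, h, hs, hcmp, rfl⟩)
  · exact (hfatou.trans (sInf_le ⟨t₀, g₀, h₀, le_rfl, rfl⟩)).trans hcmp

theorem theorem1 (n d : ℕ) (hd : Even d) (hd_pos : 0 < d)
    (f : (Fin n → ℝ) → ℝ) (hf_conc : IsLogConcave f) (hf_int : Integrable f)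
    (hf_pos : 0 < ∫ x, f x) (hf_sup : IsLUB (Set.range f) 1) (hf_zero : f 0 = 1) :
    (∀ (t : ℝ) (g : MvPolynomial (Fin n) ℝ), IsAdmissible f d t g →
      objective d t g = ENNReal.ofReal t * (n.factorial : ENNReal) * volume (sublevelOne g)) ∧
    ∃ t₁ : ℝ, 1 ≤ t₁ ∧ ∃ g₁ ∈ finiteVolumeForms n d, IsSolution f d t₁ g₁ := by
  have hobj : ∀ (t : ℝ) (g : MvPolynomial (Fin n) ℝ), IsAdmissible f d t g →
      objective d t g = ENNReal.ofReal t * (n.factorial : ENNReal) * volume (sublevelOne g) :=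
    fun t g h => objective_eq hd_pos (by linarith [h.one_le]) h.homogeneous h.nonneg
  refine ⟨hobj, ?_⟩
  obtain ⟨t₀, κ, ht₀, hκ, hdecay⟩ := exists_exponential_decay hf_conc hf_int hf_pos
    (fun x => hf_sup.1 ⟨x, rfl⟩) hf_zero
  obtain ⟨g₀, h₀, hfin⟩ := exists_admissible_objective_lt_top hd hd_pos ht₀ hκ hdecay
  obtain ⟨a, ha0, ha1, x₀, r, hr, hball⟩ := exists_superlevel_ball hf_conc hf_int hf_pos
  obtain ⟨t₁, g₁, hsol⟩ := exists_isSolution hd_pos ha0 ha1 hr hball h₀ hfin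
  refine ⟨t₁, hsol.1.one_le, g₁, ⟨hsol.1.homogeneous, ?_⟩, hsol⟩
  have h1 : objective d t₁ g₁ < ⊤ := (hsol.2 _ _ h₀).trans_lt hfin
  rw [hobj _ _ hsol.1] at h1
  -- As `t₁ n!` is nonzero, a finite product forces a finite volume.
  refine ENNReal.lt_top_of_mul_ne_top_right h1.ne (mul_ne_zero ?_ ?_)
  · exact (ENNReal.ofReal_pos.2 (by linarith [hsol.1.one_le])).ne'
  · exact_mod_cast n.factorial_ne_zero
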